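/- Let $\mathbb F$ denote a field and let $n \ge 3$. For a matrix $\mathfrak q = (q_{ij})$ of size $n \times n$ with entries in $\mathbb F^\ast$ that is multiplicatively antisymmetric ($q_{ii} = 1$ and $q_{ji} = q_{ij}^{-1}$), let $\mathcal O_{\mathfrak q}$ be the quotient of the free algebra $\mathbb F\{X_1, \dots, X_n\}$ by the two-sided ideal generated by $X_iX_j - q_{ij}X_jX_i$ $(1 \le i < j \le n)$. Its $\lambda$-group is the subgroup of $\mathbb F^\ast$ generated by all the $q_{ij}$. The rank of an abelian group $A$ is $\dim_{\mathbb Q}(\mathbb Q \otimes_{\mathbb Z} A)$. The torus $(\mathbb F^\ast)^n$ acts on $\mathcal O_{\mathfrak q}$ by the scalar automorphisms $X_i \mapsto t_i X_i$. Put $c = \binom{n-1}{2} + 1$. 1. If the $\lambda$-group of $\mathcal O_{\mathfrak q}$ is torsion-free of rank at least $c$, then $\mathrm{Aut}_{\mathbb F}(\mathcal O_{\mathfrak q}) = (\mathbb F^\ast)^n$, that is, $(\mathbb F^\ast)^n$ acts faithfully and every $\mathbb F$-algebra automorphism of $\mathcal O_{\mathfrak q}$ is a scalar automorphism. 2. The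 number $c$ is minimal with this property: if $m$ is a natural number such that, for this $n$, over every field every $\mathcal O_{\mathfrak q}$ with torsion-free $\lambda$-group of rank at least $m$ satisfies $\mathrm{Aut}_{\mathbb F}(\mathcal O_{\mathfrak q}) = (\mathbb F^\ast)^n$, then $m \ge c$. 3. For every integer $0 \le r < c$ there are a field $\mathbb F$ and an algebra $\mathcal O_{\mathfrak q}$ over $\mathbb F$ whose $\lambda$-group is isomorphic to $\mathbb Z^r$ and whose automorphism group contains $(\mathbb F^\ast)^n \rtimes \mathbb F^+$. More precisely, for some $k$ there is an injective group homomorphism $(\mathbb F^\ast)^n \rtimes \mathbb F^+ \to \mathrm{Aut}_{\mathbb F}(\mathcal O_{\mathfrak q})$, where $t \in (\mathbb F^\ast)^n$ acts on the additive group $\mathbb F^+$ as multiplication by $t_k^{-1}$, which sends each $t \in (\mathbb F^\ast)^n$ to the scalar automorphism $X_i \mapsto t_iX_i$. Such an $\mathcal O_{\mathfrak q}$ exists over every field $\mathbb F$ for which $\mathbb F^\ast$ has rank at least $r$. -/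

import Mathlib

universe u

open scoped TensorProduct

namespace QuantumSpace

/-- A matrix with entries in `Fˣ` is multiplicatively antisymmetric if `q i i = 1` and
`q j i = (q i j)⁻¹` for all `i`, `j`. -/
def IsMulAntisymm {F : Type u} [Field F] {n : ℕ} (q : Matrix (Fin n) (Fin n) Fˣ) : Prop :=
  (∀ i, q i i = 1) ∧ ∀ i j, q j i = (q i j)⁻¹

/-- The defining relations `X i * X j = q i j • (X j * X i)`, `i < j`, on the free algebra. -/
inductive Rel {F : Type u} [Field F] {n : ℕ} (q : Matrix (Fin n) (Fin n) Fˣ) :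
    FreeAlgebra F (Fin n) → FreeAlgebra F (Fin n) → Prop
  | comm (i j : Fin n) (hij : i < j) :
      Rel q (FreeAlgebra.ι F i * FreeAlgebra.ι F j)
        ((q i j : F) • (FreeAlgebra.ι F j * FreeAlgebra.ι F i))

/-- The quantum affine space `𝒪_q`: the quotient of the free algebra on `X 0, …, X (n - 1)` by the
two-sided ideal generated by the defining relations. -/
abbrev Affine {F : Type u} [Field F] {n : ℕ} (q : Matrix (Fin n) (Fin n) Fˣ) : Type u :=
  RingQuot (Rel q)

/-- The generator `X i` of `𝒪_q`. -/
noncomputable def X {F : Type u} [Field F] {n : ℕ} (q : Matrix (Fin n) (Fin n) Fˣ) (i : Fin n) :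
    Affine q :=
  RingQuot.mkAlgHom F (Rel q) (FreeAlgebra.ι F i)

/-- The `λ`-group of `𝒪_q`: the subgroup of `Fˣ` generated by all the `q i j`. -/
def lambdaGroup {F : Type u} [Field F] {n : ℕ} (q : Matrix (Fin n) (Fin n) Fˣ) : Subgroup Fˣ :=
  Subgroup.closure {a | ∃ i j, a = q i j}

/-- The (torsion-free) rank `dim_ℚ (ℚ ⊗_ℤ A)` of an abelian group `A`, written multiplicatively. -/
noncomputable def rk (A : Type u) [CommGroup A] : Cardinal.{u} :=
  Module.rank ℚ (ℚ ⊗[ℤ] Additive A)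

section Scalar

variable {F : Type u} [Field F] {n : ℕ} (q : Matrix (Fin n) (Fin n) Fˣ)

theorem X_mul_X {i j : Fin n} (hij : i < j) : X q i * X q j = (q i j : F) • (X q j * X q i) := by
  have h := RingQuot.mkAlgHom_rel F (Rel.comm (q := q) i j hij)
  simpa [X] using h

theorem algHom_ext {f g : Affine q →ₐ[F] Affine q} (h : ∀ i, f (X q i) = g (X q i)) : f = g := by
  apply RingQuot.ringQuot_ext'
  apply FreeAlgebra.hom_ext
  funext i
  exact h i

/-- The algebra endomorphism of `𝒪_q` with `X i ↦ t i • X i`. -/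
noncomputable def scalarHom (t : Fin n → Fˣ) : Affine q →ₐ[F] Affine q :=
  RingQuot.liftAlgHom F ⟨FreeAlgebra.lift F (fun i => (t i : F) • X q i), by
    rintro _ _ ⟨i, j, hij⟩
    simp only [map_mul, map_smul, FreeAlgebra.lift_ι_apply, smul_mul_assoc, mul_smul_comm,
      X_mul_X q hij, smul_smul]
    congr 1
    ring⟩

theorem scalarHom_X (t : Fin n → Fˣ) (i : Fin n) : scalarHom q t (X q i) = (t i : F) • X q i := by
  simp [scalarHom, X]

theorem scalarHom_one : scalarHom q 1 = AlgHom.id F (Affine q) :=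
  algHom_ext q fun i => by simp [scalarHom_X]

theorem scalarHom_mul (s t : Fin n → Fˣ) :
    scalarHom q (s * t) = (scalarHom q s).comp (scalarHom q t) :=
  algHom_ext q fun i => by simp [scalarHom_X, smul_smul, mul_comm]

/-- The action of the torus `(Fˣ)ⁿ` on `𝒪_q` by scalar automorphisms: `t` acts as the
`F`-algebra automorphism with `X i ↦ t i • X i`. -/
noncomputable def torus : (Fin n → Fˣ) →* (Affine q ≃ₐ[F] Affine q) where
  toFun t := AlgEquiv.ofAlgHom (scalarHom q t) (scalarHom q t⁻¹)
    (by rw [← scalarHom_mul, mul_inv_cancel, scalarHom_one])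
    (by rw [← scalarHom_mul, inv_mul_cancel, scalarHom_one])
  map_one' := by
    ext x
    simp [scalarHom_one]
  map_mul' s t := by
    ext x
    simp [scalarHom_mul]

theorem torus_X (t : Fin n → Fˣ) (i : Fin n) : torus q t (X q i) = (t i : F) • X q i :=
  scalarHom_X q t i

end Scalar

/-- `Aut_F(𝒪_q) = (Fˣ)ⁿ`: the torus acts faithfully, and every `F`-algebra automorphism of `𝒪_q`
comes from it. -/
def AutEqTorus {F : Type u} [Field F] {n : ℕ} (q : Matrix (Fin n) (Fin n) Fˣ) : Prop :=
  Function.Bijective (torus q)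

/-- The action of `(Fˣ)ⁿ` on the additive group of `F` in which `t` acts as multiplication by
`(t k)⁻¹`. This is how the scalar automorphism of `t` acts by conjugation
(`φ ↦ τ ∘ φ ∘ τ⁻¹`) on translations `X k ↦ X k + b`. -/
def coordAction (F : Type u) [Field F] {n : ℕ} (k : Fin n) :
    (Fin n → Fˣ) →* MulAut (Multiplicative F) where
  toFun t := AddEquiv.toMultiplicative (DistribMulAction.toAddEquiv F (t k)⁻¹)
  map_one' := by
    ext b
    simp
  map_mul' s t := by
    ext b
    simp [mul_smul, mul_comm]

/-- `Aut_F(𝒪_q)` contains `(Fˣ)ⁿ ⋊ F⁺`: for some `k` there is an embedding of the semidirect product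
of `F⁺` by `(Fˣ)ⁿ` (acting through its `k`-th coordinate) into `Aut_F(𝒪_q)` which on `(Fˣ)ⁿ` is the
action by scalar automorphisms. -/
def AutContainsSemidirect {F : Type u} [Field F] {n : ℕ} (q : Matrix (Fin n) (Fin n) Fˣ) : Prop :=
  ∃ (k : Fin n) (f : Multiplicative F ⋊[coordAction F k] (Fin n → Fˣ) →* (Affine q ≃ₐ[F] Affine q)),
    Function.Injective f ∧ ∀ t, f (SemidirectProduct.inr t) = torus q t

end QuantumSpace

/-! Order exponents by weights. The lowest exponents of nonzero x and y add up to an exponent of x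
y, and if x y = c y x, then their monomials commute up to the same c (`exists_lowest`). So for an
automorphism φ the lowest exponents of φ(X_i) and φ(X_j) have commutation character q_ij, whatever
the weights.

Rigidity comes from varying the weights. If every q_ij of some row i lay in the group generated by
the entries avoiding i, then the λ-group would need only binom(n-1, 2) generators
(`rk_lambdaGroup_le`). Rank c forbids this, and torsion-freeness forbids entries of order two; this
is `IsRigid`. Ordering by total degree shows that φ(X_i) has no constant term and that its linear
part is a nonzero multiple of X_i. Ordering by the degree in X_i then shows that X_i divides every
monomial of φ(X_i). The same holds for φ⁻¹, so φ(X_i) = X_i z with z invertible, hence scalar.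

Below the bound, r independent units fit on the pairs avoiding a fixed k. Then X_k is central and
the translations X_k ↦ X_k + b are automorphisms. Over ℚ the primes supply the units, which also
gives minimality. -/

namespace QuantumSpace

/-! ### Monomial basis and lowest exponents -/

section Monomials

variable {F : Type u} [Field F] {n : ℕ} (q : Matrix (Fin n) (Fin n) Fˣ)

theorem X_mul_X_of_isMulAntisymm {q : Matrix (Fin n) (Fin n) Fˣ} (hq : IsMulAntisymm q)
    (i j : Fin n) : X q i * X q j = (q i j : F) • (X q j * X q i) := by
  rcases lt_trichotomy i j with h | rfl | h
  · exact X_mul_X q h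
  · simp [hq.1]
  · rw [X_mul_X q h, smul_smul, hq.2 j i]
    simp

/-- The product of the generators along a word. -/
noncomputable def word (w : List (Fin n)) : Affine q := (w.map (X q)).prod

theorem word_cons (i : Fin n) (w : List (Fin n)) : word q (i :: w) = X q i * word q w := by
  simp [word]

theorem word_append (v w : List (Fin n)) : word q (v ++ w) = word q v * word q w := by
  simp [word]

/-- The monomial with a given multiset of variables, multiplied in some order. -/
noncomputable def mono (s : Multiset (Fin n)) : Affine q := word q s.toList

theorem mono_zero : mono q 0 = 1 := by simp [mono, word]

theorem mono_singleton (i : Fin n) : mono q {i} = X q i := by simp [mono, word]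

variable {q}

theorem word_perm (hq : IsMulAntisymm q) {v w : List (Fin n)} (h : v.Perm w) :
    ∃ c : Fˣ, word q v = c • word q w := by
  induction h with
  | nil => exact ⟨1, by simp⟩
  | @cons i v w _ ih =>
    obtain ⟨c, hc⟩ := ih
    exact ⟨c, by rw [word_cons, word_cons, hc, mul_smul_comm]⟩
  | swap i j w =>
    refine ⟨q j i, ?_⟩
    rw [word_cons, word_cons, word_cons, word_cons, ← mul_assoc, ← mul_assoc,
      X_mul_X_of_isMulAntisymm hq j i, smul_mul_assoc, Units.smul_def]
  | trans _ _ ih₁ ih₂ =>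
    obtain ⟨c, hc⟩ := ih₁
    obtain ⟨d, hd⟩ := ih₂
    exact ⟨c * d, by rw [hc, hd, mul_smul]⟩

theorem word_eq_smul_mono (hq : IsMulAntisymm q) (w : List (Fin n)) :
    ∃ c : Fˣ, word q w = c • mono q (w : Multiset (Fin n)) :=
  word_perm hq (Multiset.coe_eq_coe.1 (by simp))

theorem mono_mul_mono (hq : IsMulAntisymm q) (s t : Multiset (Fin n)) :
    ∃ c : Fˣ, mono q s * mono q t = c • mono q (s + t) := by
  rw [mono, mono, ← word_append]
  obtain ⟨c, hc⟩ := word_eq_smul_mono hq (s.toList ++ t.toList)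
  refine ⟨c, ?_⟩
  rw [hc, ← Multiset.coe_add, Multiset.coe_toList, Multiset.coe_toList]

/-- The commutation character of two monomials. -/
def chi {G : Type*} [CommGroup G] (p : Fin n → Fin n → G) (s t : Multiset (Fin n)) : G :=
  (s.map fun i => (t.map fun j => p i j).prod).prod

theorem X_mul_word (hq : IsMulAntisymm q) (i : Fin n) (w : List (Fin n)) :
    X q i * word q w = (w.map fun j => q i j).prod • (word q w * X q i) := by
  induction w with
  | nil => simp [word]
  | cons j w ih =>
    rw [word_cons, ← mul_assoc, X_mul_X_of_isMulAntisymm hq i j, smul_mul_assoc, mul_assoc, ih,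
      List.map_cons, List.prod_cons, mul_smul, mul_smul_comm, Units.smul_def (q i j), mul_assoc]

theorem word_mul_word (hq : IsMulAntisymm q) (v w : List (Fin n)) :
    word q v * word q w = chi q (v : Multiset (Fin n)) w • (word q w * word q v) := by
  induction v with
  | nil => simp [word, chi]
  | cons i v ih =>
    rw [word_cons, mul_assoc, ih, mul_smul_comm, ← mul_assoc, X_mul_word hq, smul_mul_assoc,
      smul_smul, mul_assoc]
    simp [chi, mul_comm]

theorem mono_mul_mono_comm (hq : IsMulAntisymm q) (s t : Multiset (Fin n)) :
    mono q s * mono q t = chi q s t • (mono q t * mono q s) := by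
  simpa [mono] using word_mul_word hq s.toList t.toList

variable (q)

/-- Left multiplication by `X i` on normally ordered monomials. -/
noncomputable def leftOp (i : Fin n) :
    (Multiset (Fin n) →₀ F) →ₗ[F] (Multiset (Fin n) →₀ F) :=
  Finsupp.linearCombination F fun s =>
    -- Normal order is increasing: X_i moves right past each X_j with j < i, at the cost of q_ij.
    Finsupp.single (i ::ₘ s) (((s.map fun j => if j < i then q i j else 1).prod : Fˣ) : F)

theorem leftOp_single (i : Fin n) (s : Multiset (Fin n)) (c : F) :
    leftOp q i (Finsupp.single s c) = Finsupp.single (i ::ₘ s)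
      (c * (((s.map fun j => if j < i then q i j else 1).prod : Fˣ) : F)) := by
  simp [leftOp]

variable {q}

theorem leftOp_mul_leftOp {i j : Fin n} (hij : i < j) (hq : IsMulAntisymm q) :
    (leftOp q i : Module.End F (Multiset (Fin n) →₀ F)) * leftOp q j =
      (q i j : F) • (leftOp q j * leftOp q i) := by
  refine Finsupp.lhom_ext fun s c => ?_
  simp only [Module.End.mul_apply, leftOp_single, LinearMap.smul_apply, Multiset.cons_swap i j,
    Multiset.map_cons, Multiset.prod_cons, hij, hij.not_gt, if_true, if_false, one_mul,
    Finsupp.smul_single, smul_eq_mul, Units.val_mul, hq.2 i j]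
  congr 1
  have := (q i j).mul_inv
  linear_combination (-(c * (((s.map fun k => if k < j then q j k else 1).prod : Fˣ) : F) *
    (((s.map fun k => if k < i then q i k else 1).prod : Fˣ) : F))) * this

/-- The representation of `𝒪_q` on normally ordered monomials. -/
noncomputable def rep (hq : IsMulAntisymm q) :
    Affine q →ₐ[F] Module.End F (Multiset (Fin n) →₀ F) :=
  RingQuot.liftAlgHom F ⟨FreeAlgebra.lift F (leftOp q), by
    rintro _ _ ⟨i, j, hij⟩
    simpa using leftOp_mul_leftOp hij hq⟩

theorem rep_X (hq : IsMulAntisymm q) (i : Fin n) : rep hq (X q i) = leftOp q i := by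
  simp [rep, X]

theorem rep_word (hq : IsMulAntisymm q) (w : List (Fin n)) :
    ∃ c : Fˣ, rep hq (word q w) (Finsupp.single 0 1) =
      c • Finsupp.single (w : Multiset (Fin n)) (1 : F) := by
  induction w with
  | nil => exact ⟨1, by simp [word]⟩
  | cons i w ih =>
    obtain ⟨c, hc⟩ := ih
    refine ⟨c * ((w : Multiset (Fin n)).map fun j => if j < i then q i j else 1).prod, ?_⟩
    rw [word_cons, map_mul, Module.End.mul_apply, hc, rep_X, Units.smul_def, map_smul,
      leftOp_single, mul_smul]
    simp [Units.smul_def]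

/-- In the representation `rep`, applying the monomials to the basis vector of exponent 0 gives unit
multiples of distinct basis vectors. -/
theorem linearIndependent_mono (hq : IsMulAntisymm q) : LinearIndependent F (mono q) := by
  have h : ∀ s : Multiset (Fin n), ∃ c : Fˣ, rep hq (mono q s) (Finsupp.single 0 1) =
      c • Finsupp.single s (1 : F) := fun s => by
    simpa [mono] using rep_word hq s.toList
  choose c hc using h
  refine LinearIndependent.of_comp ((LinearMap.applyₗ (Finsupp.single 0 1)).comp
    (rep hq).toLinearMap) ?_
  have := ((Finsupp.basisSingleOne (R := F) (ι := Multiset (Fin n))).unitsSMul c).linearIndependent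
  convert this using 1
  funext s
  simp [hc, Module.Basis.unitsSMul_apply]

theorem adjoin_range_X : Algebra.adjoin F (Set.range (X q)) = ⊤ := by
  have h : Set.range (X q) =
      RingQuot.mkAlgHom F (Rel q) '' Set.range (FreeAlgebra.ι F (X := Fin n)) := by
    rw [← Set.range_comp]
    rfl
  rw [h, ← AlgHom.map_adjoin, FreeAlgebra.adjoin_range_ι, Algebra.map_top, AlgHom.range_eq_top]
  exact RingQuot.mkAlgHom_surjective F _

theorem span_range_mono (hq : IsMulAntisymm q) :
    ⊤ ≤ Submodule.span F (Set.range (mono q)) := by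
  rw [← Algebra.top_toSubmodule, ← adjoin_range_X (q := q), Algebra.adjoin_eq_span,
    Submodule.span_le]
  intro x hx
  obtain ⟨l, hl, rfl⟩ := Submonoid.exists_list_of_mem_closure hx
  obtain ⟨w, rfl⟩ : ∃ w, List.map (X q) w = l := by
    rw [← Set.mem_range, Set.range_list_map]
    exact hl
  obtain ⟨c, hc⟩ := word_eq_smul_mono hq w
  change word q w ∈ _
  rw [hc]
  exact Submodule.smul_mem _ _ (Submodule.subset_span ⟨_, rfl⟩)

/-- The basis of monomials of `𝒪_q`. -/
noncomputable def monoBasis (hq : IsMulAntisymm q) : Module.Basis (Multiset (Fin n)) F (Affine q) :=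
  Module.Basis.mk (linearIndependent_mono hq) (span_range_mono hq)

theorem monoBasis_apply (hq : IsMulAntisymm q) (s : Multiset (Fin n)) :
    monoBasis hq s = mono q s := by
  simp [monoBasis]

theorem repr_mono (hq : IsMulAntisymm q) (s : Multiset (Fin n)) :
    (monoBasis hq).repr (mono q s) = Finsupp.single s 1 := by
  rw [← monoBasis_apply hq, Module.Basis.repr_self]

/-- The set of exponents of an element of `𝒪_q`. -/
noncomputable def supp (hq : IsMulAntisymm q) (x : Affine q) : Finset (Multiset (Fin n)) :=
  ((monoBasis hq).repr x).support

theorem mem_supp (hq : IsMulAntisymm q) {x : Affine q} {s : Multiset (Fin n)} :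
    s ∈ supp hq x ↔ (monoBasis hq).repr x s ≠ 0 :=
  Finsupp.mem_support_iff

theorem supp_nonempty (hq : IsMulAntisymm q) {x : Affine q} (hx : x ≠ 0) :
    (supp hq x).Nonempty := by
  simpa [supp, Finsupp.support_nonempty_iff] using hx

theorem supp_mono (hq : IsMulAntisymm q) (s : Multiset (Fin n)) : supp hq (mono q s) = {s} := by
  ext t
  rw [mem_supp, repr_mono, Finsupp.single_apply]
  simp [eq_comm]

theorem eq_sum_supp (hq : IsMulAntisymm q) (x : Affine q) :
    x = ∑ s ∈ supp hq x, (monoBasis hq).repr x s • mono q s := by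
  conv_lhs => rw [← (monoBasis hq).linearCombination_repr x, Finsupp.linearCombination_apply]
  simp [Finsupp.sum, supp, monoBasis_apply]

theorem repr_mul (hq : IsMulAntisymm q) (x y : Affine q) (r : Multiset (Fin n)) :
    (monoBasis hq).repr (x * y) r = ∑ s ∈ supp hq x, ∑ t ∈ supp hq y,
      (monoBasis hq).repr x s * (monoBasis hq).repr y t *
        (monoBasis hq).repr (mono q s * mono q t) r := by
  conv_lhs => rw [eq_sum_supp hq x, eq_sum_supp hq y]
  simp [Finset.sum_mul_sum, Finsupp.finsetSum_apply, mul_comm, mul_left_comm]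

/-- No cancellation can occur at an exponent that arises from only one pair of terms. -/
theorem repr_mul_of_unique (hq : IsMulAntisymm q) {x y : Affine q} {s t : Multiset (Fin n)}
    (hs : s ∈ supp hq x) (ht : t ∈ supp hq y)
    (h : ∀ s' ∈ supp hq x, ∀ t' ∈ supp hq y, s' + t' = s + t → s' = s) :
    (monoBasis hq).repr (x * y) (s + t) = (monoBasis hq).repr x s * (monoBasis hq).repr y t *
        (monoBasis hq).repr (mono q s * mono q t) (s + t) := by
  have key : ∀ s' ∈ supp hq x, ∀ t' ∈ supp hq y, (s' = s → t' ≠ t) →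
      (monoBasis hq).repr (mono q s' * mono q t') (s + t) = 0 := by
    intro s' hs' t' ht' hne
    obtain ⟨c, hc⟩ := mono_mul_mono hq s' t'
    rw [hc, Units.smul_def, map_smul, repr_mono, Finsupp.smul_apply, Finsupp.single_apply,
      if_neg, smul_zero]
    intro heq
    have := h s' hs' t' ht' heq
    subst this
    exact hne rfl (add_left_cancel heq)
  rw [repr_mul, Finset.sum_eq_single_of_mem s hs, Finset.sum_eq_single_of_mem t ht]
  · intro t' ht' hne
    rw [key s hs t' ht' fun _ => hne, mul_zero]
  · intro s' hs' hne
    exact Finset.sum_eq_zero fun t' ht' => by rw [key s' hs' t' ht' fun h => absurd h hne, mul_zero]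

theorem repr_mono_mul_mono_ne_zero (hq : IsMulAntisymm q) (s t : Multiset (Fin n)) :
    (monoBasis hq).repr (mono q s * mono q t) (s + t) ≠ 0 := by
  obtain ⟨c, hc⟩ := mono_mul_mono hq s t
  rw [hc, Units.smul_def, map_smul, repr_mono]
  simp

/-- The total order on exponents that compares `g` first, then `h`, then lexicographically. -/
def weight (g h : Multiset (Fin n) →+ ℤ) :
    Multiset (Fin n) →+ ℤ ×ₗ ℤ ×ₗ Lex (Fin n → ℕ) where
  toFun s := toLex (g s, toLex (h s, toLex fun i => s.count i))
  map_zero' := by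
    simp only [map_zero, Multiset.count_zero]
    rfl
  map_add' s t := by
    simp only [map_add, Multiset.count_add]
    rfl

theorem weight_injective (g h : Multiset (Fin n) →+ ℤ) : Function.Injective (weight g h) := by
  intro s t hst
  have h1 := congrArg (fun z => ofLex (ofLex (ofLex z).2).2) hst
  exact Multiset.ext.2 fun i => congrFun h1 i

/-- Lowest exponents with respect to two weights. -/
theorem exists_lowest (hq : IsMulAntisymm q) (g h : Multiset (Fin n) →+ ℤ) :
    ∃ μ : Affine q → Multiset (Fin n),
      (∀ x, x ≠ 0 → μ x ∈ supp hq x ∧ ∀ s ∈ supp hq x,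
        g (μ x) < g s ∨ g (μ x) = g s ∧ h (μ x) ≤ h s) ∧
      (∀ x y, x ≠ 0 → y ≠ 0 → μ x + μ y ∈ supp hq (x * y)) ∧
      ∀ x y, x ≠ 0 → y ≠ 0 → ∀ c : Fˣ, x * y = c • (y * x) → chi q (μ x) (μ y) = c := by
  have hex : ∀ x : Affine q, ∃ s, x ≠ 0 → s ∈ supp hq x ∧
      ∀ s' ∈ supp hq x, weight g h s ≤ weight g h s' := by
    intro x
    by_cases hx : x = 0
    · exact ⟨0, fun h => absurd hx h⟩
    · obtain ⟨s, hs⟩ := Finset.exists_min_image (supp hq x) (weight g h) (supp_nonempty hq hx)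
      exact ⟨s, fun _ => hs⟩
  choose μ hμ using hex
  -- The order is total and compatible with addition, so only the pair of minima attains the minimal
  -- sum.
  have huniq : ∀ x y, x ≠ 0 → y ≠ 0 → ∀ s ∈ supp hq x, ∀ t ∈ supp hq y,
      s + t = μ x + μ y → s = μ x := by
    intro x y hx hy s hs t ht hst
    have h1 := (hμ x hx).2 s hs
    have h2 := (hμ y hy).2 t ht
    have h3 := congrArg (weight g h) hst
    rw [map_add, map_add] at h3
    by_contra hne
    have h4 := lt_of_le_of_ne h1 fun he => hne (weight_injective g h he).symm
    exact (add_lt_add_of_lt_of_le h4 h2).ne' h3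
  have hmul : ∀ x y, x ≠ 0 → y ≠ 0 → (monoBasis hq).repr (x * y) (μ x + μ y) =
      (monoBasis hq).repr x (μ x) * (monoBasis hq).repr y (μ y) *
        (monoBasis hq).repr (mono q (μ x) * mono q (μ y)) (μ x + μ y) := fun x y hx hy =>
    repr_mul_of_unique hq (hμ x hx).1 (hμ y hy).1 (huniq x y hx hy)
  refine ⟨μ, fun x hx => ⟨(hμ x hx).1, fun s hs => ?_⟩, fun x y hx hy => ?_,
    fun x y hx hy c hc => ?_⟩
  · rcases Prod.Lex.le_iff.1 ((hμ x hx).2 s hs) with h1 | ⟨h1, h2⟩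
    · exact Or.inl h1
    · refine Or.inr ⟨h1, ?_⟩
      rcases Prod.Lex.le_iff.1 h2 with h3 | ⟨h3, _⟩
      · exact le_of_lt h3
      · exact le_of_eq h3
  · rw [mem_supp, hmul x y hx hy]
    exact mul_ne_zero (mul_ne_zero ((mem_supp hq).1 (hμ x hx).1) ((mem_supp hq).1 (hμ y hy).1))
      (repr_mono_mul_mono_ne_zero hq _ _)
  -- Compare the coefficients at `μ x + μ y`; both sides carry the same nonzero factor.
  · have h1 := congrArg (fun z => (monoBasis hq).repr z (μ x + μ y)) hc
    simp only [Units.smul_def, map_smul, Finsupp.smul_apply, smul_eq_mul] at h1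
    rw [hmul x y hx hy, mono_mul_mono_comm hq, add_comm (μ x), hmul y x hy hx, Units.smul_def,
      map_smul, Finsupp.smul_apply, smul_eq_mul] at h1
    have h2 := (mem_supp hq).1 (hμ x hx).1
    have h3 := (mem_supp hq).1 (hμ y hy).1
    have h4 := repr_mono_mul_mono_ne_zero hq (μ y) (μ x)
    apply Units.ext
    apply mul_right_cancel₀ (mul_ne_zero (mul_ne_zero h2 h3) h4)
    linear_combination h1

end Monomials

section Rigidity

variable {F : Type u} [Field F] {n : ℕ} (q : Matrix (Fin n) (Fin n) Fˣ)

/-- The subgroup generated by the entries `q k l` with `k, l ≠ i`. -/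
def awayGroup (i : Fin n) : Subgroup Fˣ :=
  Subgroup.closure {a | ∃ k l, k ≠ i ∧ l ≠ i ∧ a = q k l}

/-- No row of `q` lies in the subgroup generated by the entries outside of this row and column,
and `-1` is not an entry. -/
structure IsRigid : Prop where
  antisymm : IsMulAntisymm q
  exists_notMem : ∀ i, ∃ j, q i j ∉ awayGroup q i
  eq_one_of_sq : ∀ i j, q i j ^ 2 = 1 → q i j = 1

variable {q}

theorem mem_awayGroup {i k l : Fin n} (hk : k ≠ i) (hl : l ≠ i) : q k l ∈ awayGroup q i :=
  Subgroup.subset_closure ⟨k, l, hk, hl, rfl⟩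

theorem chi_singleton (i j : Fin n) : chi q {i} {j} = q i j := by simp [chi]

/-- If τ missed i, or if it moved i, the symmetry would carry row i to entries avoiding i. The only
exceptions to the latter involve a j with τ j = i and are treated by inversion. -/
theorem IsRigid.eq_id (hq : IsRigid q) {τ : Fin n → Fin n} (h : ∀ i j, q (τ i) (τ j) = q i j) :
    ∀ i, τ i = i := by
  have hsurj : Function.Surjective τ := by
    intro i
    by_contra! hi
    obtain ⟨j, hj⟩ := hq.exists_notMem i
    exact hj (h i j ▸ mem_awayGroup (hi i) (hi j))
  have hinj : Function.Injective τ := Finite.injective_iff_surjective.2 hsurj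
  intro i
  by_contra hi
  obtain ⟨j, hj⟩ := hq.exists_notMem i
  apply hj
  by_cases hj' : τ j = i
  · rw [← h i j, hj', hq.antisymm.2 i (τ i)]
    apply inv_mem
    by_cases hii : τ (τ i) = i
    -- Here τ swaps i and j, so q_ij equals its own inverse.
    · have hji : τ i = j := hinj (hii.trans hj'.symm)
      have h1 : q i (τ i) = (q i (τ i))⁻¹ := by
        rw [← hq.antisymm.2, ← h (τ i) i, hii]
      rw [hq.eq_one_of_sq i (τ i) (by rw [sq]; nth_rewrite 1 [h1]; simp)]
      exact one_mem _
    · rw [← h i (τ i)]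
      exact mem_awayGroup hi hii
  · rw [← h i j]
    exact mem_awayGroup hi hj'

/-- The elements all of whose exponents have total degree at least `d`. -/
noncomputable def degGE (hq : IsMulAntisymm q) (d : ℕ) : Submodule F (Affine q) :=
  Submodule.span F (monoBasis hq '' {s | d ≤ s.card})

theorem mem_degGE (hq : IsMulAntisymm q) {d : ℕ} {x : Affine q} :
    x ∈ degGE hq d ↔ ∀ s ∈ supp hq x, d ≤ s.card := by
  rw [degGE, Module.Basis.mem_span_image]
  rfl

theorem mul_mem_degGE (hq : IsMulAntisymm q) {d e : ℕ} {x y : Affine q} (hx : x ∈ degGE hq d)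
    (hy : y ∈ degGE hq e) : x * y ∈ degGE hq (d + e) := by
  have h : degGE hq d * degGE hq e ≤ degGE hq (d + e) := by
    rw [degGE, degGE, Submodule.span_mul_span, Submodule.span_le]
    rintro _ ⟨_, ⟨s, hs, rfl⟩, _, ⟨t, ht, rfl⟩, rfl⟩
    simp only [monoBasis_apply]
    obtain ⟨c, hc⟩ := mono_mul_mono hq s t
    rw [hc]
    refine Submodule.smul_mem _ _ ?_
    rw [← monoBasis_apply hq]
    refine Submodule.subset_span ⟨s + t, ?_, rfl⟩
    simp only [Set.mem_ofPred_eq, Multiset.card_add] at hs ht ⊢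
    omega
  exact h (Submodule.mul_mem_mul hx hy)

theorem map_mem_degGE (hq : IsMulAntisymm q) (φ : Affine q →ₐ[F] Affine q)
    (hφ : ∀ i, φ (X q i) ∈ degGE hq 1) {d : ℕ} {x : Affine q} (hx : x ∈ degGE hq d) :
    φ x ∈ degGE hq d := by
  have hw : ∀ w : List (Fin n), φ (word q w) ∈ degGE hq w.length := by
    intro w
    induction w with
    | nil => exact (mem_degGE hq).2 fun s _ => Nat.zero_le _
    | cons i w ih =>
      rw [word_cons, map_mul, List.length_cons, add_comm]
      exact mul_mem_degGE hq (hφ i) ih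
  have h : degGE hq d ≤ (degGE hq d).comap φ.toLinearMap := by
    conv_lhs => rw [degGE]
    rw [Submodule.span_le]
    rintro _ ⟨s, hs, rfl⟩
    refine (mem_degGE hq).2 fun t ht => le_trans hs ?_
    rw [monoBasis_apply] at ht
    simpa using (mem_degGE hq).1 (hw s.toList) t ht
  exact h hx

theorem X_ne_zero (hq : IsMulAntisymm q) (i : Fin n) : X q i ≠ 0 := by
  rw [← mono_singleton, ← monoBasis_apply hq]
  exact (monoBasis hq).ne_zero _

theorem supp_X (hq : IsMulAntisymm q) (i : Fin n) : supp hq (X q i) = {{i}} := by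
  rw [← mono_singleton, supp_mono]

/-- Total degree of an exponent. -/
def degree : Multiset (Fin n) →+ ℤ := (Nat.castAddMonoidHom ℤ).comp Multiset.cardHom

/-- Multiplicity of a variable in an exponent. -/
def degreeIn (i : Fin n) : Multiset (Fin n) →+ ℤ :=
  (Nat.castAddMonoidHom ℤ).comp (Multiset.countAddMonoidHom i)

theorem degree_apply (s : Multiset (Fin n)) : degree s = s.card := rfl

theorem degreeIn_apply (i : Fin n) (s : Multiset (Fin n)) : degreeIn i s = s.count i := rfl

theorem map_X_mul_map_X (hq : IsMulAntisymm q) (φ : Affine q →ₐ[F] Affine q) (i j : Fin n) :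
    φ (X q i) * φ (X q j) = q i j • (φ (X q j) * φ (X q i)) := by
  rw [← map_mul, X_mul_X_of_isMulAntisymm hq, map_smul, map_mul, Units.smul_def]

theorem map_X_ne_zero (hq : IsMulAntisymm q) (φ : Affine q ≃ₐ[F] Affine q) (i : Fin n) :
    φ (X q i) ≠ 0 :=
  (map_ne_zero_iff φ φ.injective).2 (X_ne_zero hq i)

/-- A constant term would be lowest for the total degree. Constants commute with everything, which
would make the whole row i trivial. -/
theorem IsRigid.zero_notMem_supp (hq : IsRigid q) (φ : Affine q ≃ₐ[F] Affine q) (i : Fin n) :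
    0 ∉ supp hq.antisymm (φ (X q i)) := by
  intro h0
  obtain ⟨μ, hμ, -, hcomm⟩ := exists_lowest hq.antisymm (degree (n := n)) 0
  have h1 : μ (φ (X q i)) = 0 := by
    have := (hμ _ (map_X_ne_zero hq.antisymm φ i)).2 0 h0
    rw [← Multiset.card_eq_zero]
    simp only [degree_apply, Multiset.card_zero] at this
    omega
  obtain ⟨j, hj⟩ := hq.exists_notMem i
  have h2 := hcomm _ _ (map_X_ne_zero hq.antisymm φ i) (map_X_ne_zero hq.antisymm φ j) _
    (map_X_mul_map_X hq.antisymm (φ : Affine q →ₐ[F] Affine q) i j)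
  rw [h1] at h2
  apply hj
  rw [← h2]
  simp [chi, one_mem]

theorem IsRigid.map_X_mem_degGE (hq : IsRigid q) (φ : Affine q ≃ₐ[F] Affine q) (i : Fin n) :
    φ (X q i) ∈ degGE hq.antisymm 1 := by
  rw [mem_degGE]
  intro s hs
  rw [Nat.one_le_iff_ne_zero, Ne, Multiset.card_eq_zero]
  rintro rfl
  exact hq.zero_notMem_supp φ i hs

/-- Neither φ nor φ⁻¹ lowers the order of vanishing. Without linear terms φ(X_i) would have order at
least 2, and so would X_i = φ⁻¹(φ(X_i)). -/
theorem IsRigid.exists_singleton_mem_supp (hq : IsRigid q) (φ : Affine q ≃ₐ[F] Affine q)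
    (i : Fin n) : ∃ j, {j} ∈ supp hq.antisymm (φ (X q i)) := by
  by_contra! h
  have h1 : φ (X q i) ∈ degGE hq.antisymm 2 := by
    rw [mem_degGE]
    intro s hs
    have h2 := (mem_degGE _).1 (hq.map_X_mem_degGE φ i) s hs
    have h3 : s.card ≠ 1 := by
      rw [Ne, Multiset.card_eq_one]
      rintro ⟨j, rfl⟩
      exact h j hs
    omega
  have h2 := map_mem_degGE hq.antisymm (φ.symm : Affine q →ₐ[F] Affine q)
    (hq.map_X_mem_degGE φ.symm) h1
  have h3 := (mem_degGE hq.antisymm).1 h2 {i} (by simp [supp_X])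
  simp at h3

theorem IsRigid.eq_of_singleton_mem_supp (hq : IsRigid q) (φ : Affine q ≃ₐ[F] Affine q)
    {i l : Fin n} (hl : {l} ∈ supp hq.antisymm (φ (X q i))) : l = i := by
  -- On exponents of degree 1 the second weight is 0 at `{l}` and 1 elsewhere, so `{l}` is chosen
  -- whenever it occurs.
  obtain ⟨μ, hμ, -, hcomm⟩ := exists_lowest hq.antisymm (degree (n := n)) (degree - degreeIn l)
  have h1 : ∀ j, ∃ k, μ (φ (X q j)) = {k} := by
    intro j
    obtain ⟨k, hk⟩ := hq.exists_singleton_mem_supp φ j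
    obtain ⟨hm, hlow⟩ := hμ _ (map_X_ne_zero hq.antisymm φ j)
    have h2 := hlow _ hk
    have h3 := (mem_degGE _).1 (hq.map_X_mem_degGE φ j) _ hm
    rw [← Multiset.card_eq_one]
    simp only [degree_apply, Multiset.card_singleton] at h2
    omega
  choose τ hτ using h1
  have h2 := hq.eq_id (τ := τ) fun j k => by
    have h := hcomm _ _ (map_X_ne_zero hq.antisymm φ j) (map_X_ne_zero hq.antisymm φ k) _
      (map_X_mul_map_X hq.antisymm (φ : Affine q →ₐ[F] Affine q) j k)
    rwa [hτ, hτ, chi_singleton] at h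
  have h3 := (hμ _ (map_X_ne_zero hq.antisymm φ i)).2 _ hl
  rw [hτ, h2] at h3
  by_contra hne
  simp [degree_apply, degreeIn_apply, hne] at h3

theorem IsRigid.mem_of_mem_supp (hq : IsRigid q) (φ : Affine q ≃ₐ[F] Affine q)
    {i : Fin n} {s : Multiset (Fin n)} (hs : s ∈ supp hq.antisymm (φ (X q i))) : i ∈ s := by
  by_contra his
  -- For j ≠ i these weights select `{j}` in φ(X_j). An exponent of φ(X_i) avoiding i would force
  -- the selected one to avoid i too, and q_ij would be a product of entries avoiding i.
  obtain ⟨μ, hμ, -, hcomm⟩ := exists_lowest hq.antisymm (degreeIn i) (degree (n := n))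
  have h1 : ∀ j, j ≠ i → μ (φ (X q j)) = {j} := by
    intro j hj
    obtain ⟨hm, hlow⟩ := hμ _ (map_X_ne_zero hq.antisymm φ j)
    obtain ⟨k, hk⟩ := hq.exists_singleton_mem_supp φ j
    obtain rfl := hq.eq_of_singleton_mem_supp φ hk
    have h2 := hlow _ hk
    have h3 := (mem_degGE _).1 (hq.map_X_mem_degGE φ k) _ hm
    simp only [degree_apply, degreeIn_apply, Multiset.card_singleton,
      Multiset.count_singleton, if_neg hj.symm] at h2
    obtain ⟨l, hl⟩ : ∃ l, μ (φ (X q k)) = {l} := by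
      rw [← Multiset.card_eq_one]
      omega
    rw [hl] at hm ⊢
    rw [hq.eq_of_singleton_mem_supp φ hm]
  have h2 : i ∉ μ (φ (X q i)) := by
    have h3 := (hμ _ (map_X_ne_zero hq.antisymm φ i)).2 s hs
    simp only [degreeIn_apply, Multiset.count_eq_zero_of_notMem his] at h3
    rw [← Multiset.count_eq_zero]
    omega
  obtain ⟨j, hj⟩ := hq.exists_notMem i
  apply hj
  by_cases hji : j = i
  · rw [hji, hq.antisymm.1]
    exact one_mem _
  rw [← hcomm _ _ (map_X_ne_zero hq.antisymm φ i) (map_X_ne_zero hq.antisymm φ j) _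
    (map_X_mul_map_X hq.antisymm (φ : Affine q →ₐ[F] Affine q) i j), h1 j hji]
  unfold chi
  refine Subgroup.multiset_prod_mem _ _ fun a ha => ?_
  obtain ⟨k, hk, rfl⟩ := Multiset.mem_map.1 ha
  simp only [Multiset.map_singleton, Multiset.prod_singleton]
  exact mem_awayGroup (fun h => h2 (h ▸ hk)) hji

theorem exists_eq_X_mul (hq : IsMulAntisymm q) {x : Affine q} {i : Fin n}
    (h : ∀ s ∈ supp hq x, i ∈ s) : ∃ z, x = X q i * z := by
  have h1 : x ∈ LinearMap.range (LinearMap.mulLeft F (X q i)) := by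
    rw [eq_sum_supp hq x]
    refine Submodule.sum_mem _ fun s hs => Submodule.smul_mem _ _ ?_
    obtain ⟨c, hc⟩ := mono_mul_mono hq {i} (s.erase i)
    rw [Multiset.singleton_add, Multiset.cons_erase (h s hs), mono_singleton] at hc
    refine ⟨c⁻¹ • mono q (s.erase i), ?_⟩
    rw [LinearMap.mulLeft_apply, mul_smul_comm, hc, inv_smul_smul]
  obtain ⟨z, hz⟩ := h1
  exact ⟨z, hz.symm⟩

theorem mul_ne_zero_affine (hq : IsMulAntisymm q) {x y : Affine q} (hx : x ≠ 0) (hy : y ≠ 0) :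
    x * y ≠ 0 := by
  obtain ⟨μ, -, hmul, -⟩ := exists_lowest hq 0 0
  intro h
  have := hmul x y hx hy
  rw [h, mem_supp] at this
  simp at this

theorem eq_smul_one_of_mul_eq_one (hq : IsMulAntisymm q) {x y : Affine q} (h : x * y = 1) :
    ∃ c : F, x = c • 1 := by
  -- For `-degree`, lowest means of greatest total degree.
  obtain ⟨μ, hμ, hmul, -⟩ := exists_lowest hq (-degree) 0
  by_cases h01 : (1 : Affine q) = 0
  · exact ⟨0, by rw [← mul_one x, h01]; simp⟩
  have hx : x ≠ 0 := by rintro rfl; exact h01 (by rw [← h, zero_mul])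
  have hy : y ≠ 0 := by rintro rfl; exact h01 (by rw [← h, mul_zero])
  have h1 := hmul x y hx hy
  rw [h, ← mono_zero, supp_mono, Finset.mem_singleton, add_eq_zero] at h1
  have h2 : supp hq x ⊆ {0} := by
    intro s hs
    have h3 := (hμ x hx).2 s hs
    rw [h1.1] at h3
    rw [Finset.mem_singleton, ← Multiset.card_eq_zero]
    simp only [AddMonoidHom.neg_apply, degree_apply, Multiset.card_zero] at h3
    omega
  refine ⟨(monoBasis hq).repr x 0, ?_⟩
  conv_lhs => rw [eq_sum_supp hq x]
  rw [Finset.sum_subset h2 fun s _ hs => by rw [mem_supp, not_not] at hs; rw [hs, zero_smul],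
    Finset.sum_singleton, mono_zero]

theorem IsRigid.exists_map_X (hq : IsRigid q) (φ : Affine q ≃ₐ[F] Affine q) (i : Fin n) :
    ∃ c : Fˣ, φ (X q i) = (c : F) • X q i := by
  obtain ⟨z, hz⟩ := exists_eq_X_mul hq.antisymm fun s hs => hq.mem_of_mem_supp φ hs
  obtain ⟨z', hz'⟩ := exists_eq_X_mul hq.antisymm fun s hs => hq.mem_of_mem_supp φ.symm hs
  -- Apply φ to φ⁻¹(X_i) = X_i z' to get X_i = X_i z φ(z').
  have h1 : X q i * (z * φ z' - 1) = 0 := by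
    rw [mul_sub, mul_one, ← mul_assoc, ← hz, ← map_mul, ← hz', AlgEquiv.apply_symm_apply, sub_self]
  have h2 : z * φ z' = 1 := by
    by_contra hne
    exact mul_ne_zero_affine hq.antisymm (X_ne_zero hq.antisymm i) (sub_ne_zero.2 hne) h1
  obtain ⟨c, rfl⟩ := eq_smul_one_of_mul_eq_one hq.antisymm h2
  have hc : c ≠ 0 := by
    rintro rfl
    exact map_X_ne_zero hq.antisymm φ i (by rw [hz, zero_smul, mul_zero])
  exact ⟨Units.mk0 c hc, by rw [hz, mul_smul_comm, mul_one, Units.val_mk0]⟩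

theorem torus_injective (hq : IsMulAntisymm q) : Function.Injective (torus q) := by
  intro s t hst
  funext i
  have h := DFunLike.congr_fun hst (X q i)
  rw [torus_X, torus_X] at h
  exact Units.ext (smul_left_injective F (X_ne_zero hq i) h)

theorem IsRigid.autEqTorus (hq : IsRigid q) : AutEqTorus q := by
  refine ⟨torus_injective hq.antisymm, fun φ => ?_⟩
  choose t ht using hq.exists_map_X φ
  refine ⟨t, ?_⟩
  have : (torus q t : Affine q →ₐ[F] Affine q) = φ :=
    algHom_ext q fun i => (torus_X q t i).trans (ht i).symm
  exact AlgEquiv.ext fun x => DFunLike.congr_fun this x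

end Rigidity

/-! ### Ranks of λ-groups and of unit groups -/

section Rank

/-- ℚ is the localization of ℤ at its nonzero elements, and localization preserves rank. -/
theorem rk_eq_rank_int (A : Type u) [CommGroup A] : rk A = Module.rank ℤ (Additive A) := by
  let f : Additive A →ₗ[ℤ] ℚ ⊗[ℤ] Additive A := TensorProduct.mk ℤ ℚ (Additive A) 1
  have hf : IsLocalizedModule (nonZeroDivisors ℤ) f :=
    (isLocalizedModule_iff_isBaseChange _ ℚ _).mpr (TensorProduct.isBaseChange _ _ _)
  have h1 : Module.rank ℚ (ℚ ⊗[ℤ] Additive A) = Module.rank ℤ (ℚ ⊗[ℤ] Additive A) :=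
    IsLocalization.rank_eq ℚ (nonZeroDivisors ℤ) le_rfl
  have h2 : Module.rank ℤ (ℚ ⊗[ℤ] Additive A) = Module.rank ℤ (Additive A) :=
    IsLocalizedModule.rank_eq (nonZeroDivisors ℤ) le_rfl f
  exact h1.trans h2

theorem rk_closure_le {G : Type u} [CommGroup G] (S : Finset G) :
    rk (Subgroup.closure (S : Set G)) ≤ S.card := by
  let x : S → Additive (Subgroup.closure (S : Set G)) := fun s =>
    Additive.ofMul ⟨s, Subgroup.subset_closure s.2⟩
  have h : ⊤ ≤ Submodule.span ℤ (Set.range x) := by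
    rintro ⟨a, ha⟩ -
    induction ha using Subgroup.closure_induction with
    | mem a ha => exact Submodule.subset_span ⟨⟨a, ha⟩, rfl⟩
    | one => exact Submodule.zero_mem _
    | mul a b _ _ iha ihb => exact Submodule.add_mem _ iha ihb
    | inv a _ iha => exact Submodule.neg_mem _ iha
  rw [rk_eq_rank_int, ← rank_top, ← top_le_iff.1 h]
  refine (rank_span_le _).trans (Cardinal.mk_range_le.trans ?_)
  simp

theorem exists_linearIndependent_of_le_rk {A : Type u} [CommGroup A] {r : ℕ}
    (h : (r : Cardinal.{u}) ≤ rk A) :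
    ∃ x : Fin r → A, LinearIndependent ℤ fun m => Additive.ofMul (x m) := by
  rw [rk_eq_rank_int, Module.le_rank_iff] at h
  obtain ⟨v, hv⟩ := h
  exact ⟨fun m => (v m).toMul, hv⟩

theorem rk_of_addEquiv {A : Type u} [CommGroup A] {r : ℕ} (e : Additive A ≃+ (Fin r → ℤ)) :
    rk A = r := by
  have h := e.toIntLinearEquiv.lift_rank_eq
  rw [rk_eq_rank_int]
  simpa using h

theorem isMulTorsionFree_of_addEquiv {A : Type u} [CommGroup A] {r : ℕ}
    (e : Additive A ≃+ (Fin r → ℤ)) : IsMulTorsionFree A where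
  pow_left_injective := by
    intro k hk a b hab
    have h1 : k • e (Additive.ofMul a) = k • e (Additive.ofMul b) := by
      rw [← map_nsmul e k (Additive.ofMul a), ← map_nsmul e k (Additive.ofMul b)]
      exact congrArg (fun z => e (Additive.ofMul z)) hab
    have h2 := smul_right_injective _ hk h1
    exact Additive.ofMul.injective (e.injective h2)

theorem nonempty_closure_addEquiv {G : Type u} [CommGroup G] {r : ℕ} (x : Fin r → G)
    (hx : LinearIndependent ℤ fun m => Additive.ofMul (x m)) :
    Nonempty (Additive (Subgroup.closure (Set.range x)) ≃+ (Fin r → ℤ)) := by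
  let y : Fin r → Additive (Subgroup.closure (Set.range x)) := fun m =>
    Additive.ofMul ⟨x m, Subgroup.subset_closure ⟨m, rfl⟩⟩
  have hy : LinearIndependent ℤ y :=
    LinearIndependent.of_comp
      (MonoidHom.toAdditive (Subgroup.closure (Set.range x)).subtype).toIntLinearMap hx
  have h : ⊤ ≤ Submodule.span ℤ (Set.range y) := by
    rintro ⟨a, ha⟩ -
    induction ha using Subgroup.closure_induction with
    | mem a ha =>
      obtain ⟨m, rfl⟩ := ha
      exact Submodule.subset_span ⟨m, rfl⟩
    | one => exact Submodule.zero_mem _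
    | mul a b _ _ iha ihb => exact Submodule.add_mem _ iha ihb
    | inv a _ iha => exact Submodule.neg_mem _ iha
  exact ⟨(Module.Basis.mk hy h).equivFun.toAddEquiv⟩

/-- The `p`-adic valuation on the units of (a copy of) `ℚ`. -/
noncomputable def unitsValuation (p : ℕ) [Fact p.Prime] :
    Additive (ULift.{u} ℚ)ˣ →+ ℤ where
  toFun a := padicValRat p ((a.toMul : (ULift.{u} ℚ)ˣ) : ULift.{u} ℚ).down
  map_zero' := padicValRat.one
  map_add' a b := padicValRat.mul
    (fun h => a.toMul.ne_zero (ULift.down_injective h))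
    (fun h => b.toMul.ne_zero (ULift.down_injective h))

theorem le_rk_units_rat (r : ℕ) : (r : Cardinal.{u}) ≤ rk (ULift.{u} ℚ)ˣ := by
  have hp : ∀ m, Fact (Nat.Prime (Nat.nth Nat.Prime m)) := fun m => ⟨Nat.prime_nth_prime m⟩
  -- The valuations at the first r primes send these primes to the standard basis of ℤ^r.
  let f : Additive (ULift.{u} ℚ)ˣ →ₗ[ℤ] (Fin r → ℤ) :=
    LinearMap.pi fun m => (unitsValuation (Nat.nth Nat.Prime m)).toIntLinearMap
  have hne : ∀ m, (ULift.up (Nat.nth Nat.Prime m : ℚ) : ULift.{u} ℚ) ≠ 0 := fun m h =>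
    (hp m).out.ne_zero (by exact_mod_cast congrArg ULift.down h)
  let x : Fin r → Additive (ULift.{u} ℚ)ˣ := fun m => Additive.ofMul (Units.mk0 _ (hne m))
  have hx : LinearIndependent ℤ x := by
    refine LinearIndependent.of_comp f ?_
    suffices h : f ∘ x = Pi.basisFun ℤ (Fin r) by
      rw [h]
      exact (Pi.basisFun ℤ (Fin r)).linearIndependent
    funext m k
    rw [Pi.basisFun_apply]
    change padicValRat (Nat.nth Nat.Prime k) (Nat.nth Nat.Prime m : ℚ) = _
    rw [padicValRat.of_nat]
    by_cases hmk : k = m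
    · subst hmk
      rw [Pi.single_eq_same, padicValNat_self]
      rfl
    · rw [Pi.single_eq_of_ne hmk, padicValNat_primes]
      · rfl
      · exact fun h => hmk (Fin.ext (Nat.nth_injective Nat.infinite_setOfPred_prime h))
  rw [rk_eq_rank_int]
  simpa using hx.cardinal_lift_le_rank

/-- The unordered pairs of distinct indices different from `i`. -/
def pairsAway {n : ℕ} (i : Fin n) : Finset (Sym2 (Fin n)) :=
  ((Finset.univ.erase i).offDiag).image Sym2.mk.uncurry

theorem card_pairsAway {n : ℕ} (i : Fin n) : (pairsAway i).card = (n - 1).choose 2 := by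
  rw [pairsAway, Sym2.card_image_offDiag]
  simp

theorem mk_mem_pairsAway {n : ℕ} {i k l : Fin n} :
    s(k, l) ∈ pairsAway i ↔ k ≠ i ∧ l ≠ i ∧ k ≠ l := by
  simp only [pairsAway, Finset.mem_image, Finset.mem_offDiag, Finset.mem_erase, Finset.mem_univ,
    and_true, Prod.exists, Function.uncurry_apply_pair, Sym2.eq_iff]
  constructor
  · rintro ⟨a, b, h, ⟨rfl, rfl⟩ | ⟨rfl, rfl⟩⟩
    · exact h
    · exact ⟨h.2.1, h.1, h.2.2.symm⟩
  · exact fun h => ⟨k, l, h, Or.inl ⟨rfl, rfl⟩⟩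

variable {F : Type u} [Field F] {n : ℕ} {q : Matrix (Fin n) (Fin n) Fˣ}

theorem rk_lambdaGroup_le (hq : IsMulAntisymm q) {i : Fin n} (h : ∀ j, q i j ∈ awayGroup q i) :
    rk (lambdaGroup q) ≤ ((n - 1).choose 2 : ℕ) := by
  classical
  -- One entry per unordered pair is enough: the opposite orientation gives the inverse, and
  -- diagonal entries are 1.
  let S : Finset Fˣ := (pairsAway i).image fun p => q p.out.1 p.out.2
  have h1 : ∀ k l, k ≠ i → l ≠ i → q k l ∈ Subgroup.closure (S : Set Fˣ) := by
    intro k l hk hl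
    by_cases hkl : k = l
    · rw [hkl, hq.1]
      exact one_mem _
    have h2 : q s(k, l).out.1 s(k, l).out.2 ∈ Subgroup.closure (S : Set Fˣ) :=
      Subgroup.subset_closure
        (Finset.mem_coe.2 (Finset.mem_image_of_mem _ (mk_mem_pairsAway.2 ⟨hk, hl, hkl⟩)))
    have h3 : s(s(k, l).out.1, s(k, l).out.2) = s(k, l) := Quot.out_eq s(k, l)
    rcases Sym2.eq_iff.1 h3 with ⟨h4, h5⟩ | ⟨h4, h5⟩
    · rwa [h4, h5] at h2
    · rw [h4, h5, hq.2 k l] at h2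
      exact inv_mem_iff.1 h2
  have h2 : awayGroup q i ≤ Subgroup.closure (S : Set Fˣ) := by
    rw [awayGroup, Subgroup.closure_le]
    rintro _ ⟨k, l, hk, hl, rfl⟩
    exact h1 k l hk hl
  have h3 : lambdaGroup q = Subgroup.closure (S : Set Fˣ) := by
    apply le_antisymm
    · rw [lambdaGroup, Subgroup.closure_le]
      rintro _ ⟨k, l, rfl⟩
      by_cases hk : k = i
      · exact hk ▸ h2 (h l)
      · by_cases hl : l = i
        · rw [hq.2 l k, hl]
          exact inv_mem (h2 (h k))
        · exact h1 k l hk hl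
    · rw [Subgroup.closure_le]
      intro a ha
      obtain ⟨p, -, rfl⟩ := Finset.mem_image.1 (Finset.mem_coe.1 ha)
      exact Subgroup.subset_closure ⟨_, _, rfl⟩
  rw [h3]
  refine (rk_closure_le S).trans ?_
  rw [← card_pairsAway i]
  exact_mod_cast Finset.card_image_le

theorem isRigid_of_le_rk (hq : IsMulAntisymm q) (htf : IsMulTorsionFree (lambdaGroup q))
    (hrk : (((n - 1).choose 2 + 1 : ℕ) : Cardinal.{u}) ≤ rk (lambdaGroup q)) : IsRigid q where
  antisymm := hq
  exists_notMem i := by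
    by_contra! h
    have := hrk.trans (rk_lambdaGroup_le hq h)
    rw [Nat.cast_le] at this
    omega
  eq_one_of_sq i j h := by
    let a : lambdaGroup q := ⟨q i j, Subgroup.subset_closure ⟨i, j, rfl⟩⟩
    have h1 : a ^ 2 = 1 ^ 2 := Subtype.ext (by simpa [a] using h)
    exact congrArg Subtype.val (htf.pow_left_injective two_ne_zero h1)

end Rank

/-! ### Translations of a central variable -/

section Translations

variable {F : Type u} [Field F] {n : ℕ} {q : Matrix (Fin n) (Fin n) Fˣ}

/-- The endomorphism `X k ↦ X k + b` that exists when `X k` is central. -/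
noncomputable def translationHom (hq : IsMulAntisymm q) {k : Fin n} (hk : ∀ j, q k j = 1) (b : F) :
    Affine q →ₐ[F] Affine q :=
  RingQuot.liftAlgHom F
    ⟨FreeAlgebra.lift F fun i => X q i + algebraMap F (Affine q) ((Pi.single k b : Fin n → F) i), by
      rintro _ _ ⟨i, j, hij⟩
      simp only [map_mul, map_smul, FreeAlgebra.lift_ι_apply]
      have hX := X_mul_X q hij
      by_cases hi : i = k
      · subst hi
        rw [hk, Units.val_one, one_smul] at hX ⊢
        rw [Pi.single_eq_of_ne hij.ne', map_zero, add_zero, add_mul, mul_add, hX, Algebra.commutes]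
      · by_cases hj : j = k
        · subst hj
          have h1 : q i j = 1 := by rw [hq.2 j i, hk, inv_one]
          rw [h1, Units.val_one, one_smul] at hX ⊢
          rw [Pi.single_eq_of_ne hi, map_zero, add_zero, add_mul, mul_add, hX, Algebra.commutes]
        · rw [Pi.single_eq_of_ne hi, Pi.single_eq_of_ne hj, map_zero, add_zero, add_zero, hX]⟩

theorem translationHom_X (hq : IsMulAntisymm q) {k : Fin n} (hk : ∀ j, q k j = 1) (b : F)
    (i : Fin n) : translationHom hq hk b (X q i) =
      X q i + algebraMap F (Affine q) ((Pi.single k b : Fin n → F) i) := by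
  simp [translationHom, X]

theorem translationHom_zero (hq : IsMulAntisymm q) {k : Fin n} (hk : ∀ j, q k j = 1) :
    translationHom hq hk 0 = AlgHom.id F (Affine q) :=
  algHom_ext q fun i => by simp [translationHom_X]

theorem translationHom_add (hq : IsMulAntisymm q) {k : Fin n} (hk : ∀ j, q k j = 1) (b c : F) :
    translationHom hq hk (b + c) = (translationHom hq hk b).comp (translationHom hq hk c) :=
  algHom_ext q fun i => by
    simp only [translationHom_X, AlgHom.comp_apply, map_add, AlgHom.commutes, Pi.single_add,
      Pi.add_apply, add_assoc]

/-- The automorphisms `X k ↦ X k + b`. -/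
noncomputable def translation (hq : IsMulAntisymm q) {k : Fin n} (hk : ∀ j, q k j = 1) :
    Multiplicative F →* (Affine q ≃ₐ[F] Affine q) where
  toFun b := AlgEquiv.ofAlgHom (translationHom hq hk b.toAdd) (translationHom hq hk (-b.toAdd))
    (by rw [← translationHom_add, add_neg_cancel, translationHom_zero])
    (by rw [← translationHom_add, neg_add_cancel, translationHom_zero])
  map_one' := by
    ext x
    simp [translationHom_zero]
  map_mul' b c := by
    ext x
    simp [translationHom_add]

theorem translation_X (hq : IsMulAntisymm q) {k : Fin n} (hk : ∀ j, q k j = 1)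
    (b : Multiplicative F) (i : Fin n) : translation hq hk b (X q i) =
      X q i + algebraMap F (Affine q) ((Pi.single k b.toAdd : Fin n → F) i) :=
  translationHom_X hq hk _ i

theorem algEquiv_ext {f g : Affine q ≃ₐ[F] Affine q} (h : ∀ i, f (X q i) = g (X q i)) : f = g := by
  have : (f : Affine q →ₐ[F] Affine q) = g := algHom_ext q h
  exact AlgEquiv.ext fun x => DFunLike.congr_fun this x

/-- This is the compatibility that `SemidirectProduct.lift` requires. The scalar t_k⁻¹ survives only
on the constant b, since the last torus factor restores X_k. -/
theorem translation_coordAction (hq : IsMulAntisymm q) {k : Fin n} (hk : ∀ j, q k j = 1)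
    (t : Fin n → Fˣ) (b : Multiplicative F) :
    translation hq hk (coordAction F k t b) = torus q t * translation hq hk b * (torus q t)⁻¹ := by
  refine algEquiv_ext fun i => ?_
  rw [← map_inv, AlgEquiv.mul_apply, AlgEquiv.mul_apply, torus_X, map_smul, translation_X,
    translation_X, map_smul, map_add, torus_X, AlgEquiv.commutes, smul_add, smul_smul,
    Pi.inv_apply, Units.inv_mul, one_smul]
  congr 1
  by_cases hi : i = k
  · subst hi
    rw [Pi.single_eq_same, Pi.single_eq_same, Algebra.algebraMap_eq_smul_one, Algebra.algebraMap_eq_smul_one, smul_smul]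
    rfl
  · rw [Pi.single_eq_of_ne hi, Pi.single_eq_of_ne hi, map_zero, smul_zero]

theorem autContainsSemidirect_of_central (hq : IsMulAntisymm q) {k : Fin n}
    (hk : ∀ j, q k j = 1) : AutContainsSemidirect q := by
  refine ⟨k, SemidirectProduct.lift (translation hq hk) (torus q) fun t => ?_, ?_, fun t => by simp⟩
  · refine MonoidHom.ext fun b => ?_
    exact translation_coordAction hq hk t b
  · rw [injective_iff_map_eq_one]
    rintro ⟨b, t⟩ h
    have h1 : ∀ i, (t i : F) • (mono q {i} + (Pi.single k b.toAdd : Fin n → F) i • mono q 0) = mono q {i} := by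
      intro i
      have := DFunLike.congr_fun h (X q i)
      simpa [SemidirectProduct.lift, torus_X, translation_X, mono_singleton, mono_zero,
        Algebra.algebraMap_eq_smul_one] using this
    have h2 : ∀ i s, (t i : F) * (Finsupp.single {i} (1 : F) s +
        (Pi.single k b.toAdd : Fin n → F) i * Finsupp.single (0 : Multiset (Fin n)) (1 : F) s) =
        Finsupp.single {i} (1 : F) s := by
      intro i s
      have := congrArg (fun z => (monoBasis hq).repr z s) (h1 i)
      simpa only [map_smul, map_add, repr_mono, Finsupp.smul_apply, Finsupp.add_apply,
        smul_eq_mul] using this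
    -- The coefficient of X_i in the image of X_i determines t_i; the constant term in the image of
    -- X_k then determines b.
    have ht : t = 1 := by
      funext i
      simpa using h2 i {i}
    have hb : b = 1 := by
      simpa using h2 k 0
    rw [ht, hb]
    rfl

/-- If the torus were everything, the image of the translation by 1 would equal that of some `inr
t`, against injectivity. -/
theorem AutContainsSemidirect.not_autEqTorus (h : AutContainsSemidirect q) : ¬ AutEqTorus q := by
  rintro ⟨-, hsurj⟩
  obtain ⟨k, f, hf, hinr⟩ := h
  obtain ⟨t, ht⟩ := hsurj (f (SemidirectProduct.inl (Multiplicative.ofAdd 1)))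
  rw [← hinr] at ht
  have h1 := congrArg SemidirectProduct.left (hf ht)
  exact one_ne_zero (congrArg Multiplicative.toAdd h1).symm

theorem exists_central_of_linearIndependent (k : Fin n) {r : ℕ} (hr : r ≤ (n - 1).choose 2)
    (x : Fin r → Fˣ) :
    ∃ q : Matrix (Fin n) (Fin n) Fˣ, IsMulAntisymm q ∧ (∀ j, q k j = 1) ∧
      lambdaGroup q = Subgroup.closure (Set.range x) := by
  classical
  have hr' : Fintype.card (Fin r) ≤ Fintype.card (pairsAway k) := by
    simpa [card_pairsAway] using hr
  obtain ⟨e⟩ := Function.Embedding.nonempty_of_card_le hr'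
  have he : Function.Injective fun m => (e m : Sym2 (Fin n)) := fun a b h =>
    e.injective (Subtype.ext h)
  -- The default value 1 covers all pairs through k, which makes X_k central.
  let g : Sym2 (Fin n) → Fˣ := Function.extend (fun m => (e m : Sym2 (Fin n))) x fun _ => 1
  have hg : ∀ p, g p ∈ Subgroup.closure (Set.range x) := by
    intro p
    by_cases hp : ∃ m, (e m : Sym2 (Fin n)) = p
    · obtain ⟨m, rfl⟩ := hp
      exact Subgroup.subset_closure ⟨m, (he.extend_apply x _ m).symm⟩
    · rw [show g p = 1 from Function.extend_apply' x _ p hp]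
      exact one_mem _
  have hgk : ∀ j, g s(k, j) = 1 := fun j => Function.extend_apply' x _ _ <| by
    rintro ⟨m, hm⟩
    have := (e m).2
    rw [hm, mk_mem_pairsAway] at this
    exact this.1 rfl
  let q : Matrix (Fin n) (Fin n) Fˣ := fun i j =>
    if i < j then g s(i, j) else if j < i then (g s(i, j))⁻¹ else 1
  have hq : ∀ i j, q i j = if i < j then g s(i, j) else if j < i then (g s(i, j))⁻¹ else 1 :=
    fun i j => rfl
  refine ⟨q, ⟨fun i => by simp [hq], fun i j => ?_⟩, fun j => by simp [hq, hgk], ?_⟩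
  · rw [hq, hq, Sym2.eq_swap]
    rcases lt_trichotomy i j with h | h | h
    · simp [h, h.not_gt]
    · simp [h]
    · simp [h, h.not_gt]
  · apply le_antisymm
    · rw [lambdaGroup, Subgroup.closure_le]
      rintro _ ⟨i, j, rfl⟩
      rw [hq]
      split_ifs
      · exact hg _
      · exact inv_mem (hg _)
      · exact one_mem _
    · rw [Subgroup.closure_le]
      rintro _ ⟨m, rfl⟩
      have hx : g (e m) = x m := he.extend_apply x _ m
      have hmem := (e m).2
      rw [← hx]
      induction hp : (e m : Sym2 (Fin n)) with
      | h i j =>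
        rw [hp, mk_mem_pairsAway] at hmem
        rcases lt_or_gt_of_ne hmem.2.2 with h | h
        · exact Subgroup.subset_closure ⟨i, j, by simp [hq, h]⟩
        · exact Subgroup.subset_closure ⟨j, i, by simp [hq, h, Sym2.eq_swap]⟩

theorem exists_autContainsSemidirect (F : Type u) [Field F] {n r : ℕ} (hn : 3 ≤ n)
    (hr : r ≤ (n - 1).choose 2) (hF : (r : Cardinal.{u}) ≤ rk Fˣ) :
    ∃ q : Matrix (Fin n) (Fin n) Fˣ, IsMulAntisymm q ∧
      Nonempty (Additive (lambdaGroup q) ≃+ (Fin r → ℤ)) ∧ AutContainsSemidirect q := by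
  obtain ⟨x, hx⟩ := exists_linearIndependent_of_le_rk hF
  obtain ⟨q, hq, hk, hΛ⟩ := exists_central_of_linearIndependent ⟨0, by omega⟩ hr x
  refine ⟨q, hq, ?_, autContainsSemidirect_of_central hq hk⟩
  rw [hΛ]
  exact nonempty_closure_addEquiv x hx

end Translations

end QuantumSpace

open QuantumSpace in
theorem theorem2 (n : ℕ) (hn : 3 ≤ n) :
    -- rigidity
    (∀ (F : Type u) [Field F] (q : Matrix (Fin n) (Fin n) Fˣ), IsMulAntisymm q →
      IsMulTorsionFree (lambdaGroup q) →
      (((n - 1).choose 2 + 1 : ℕ) : Cardinal.{u}) ≤ rk (lambdaGroup q) → AutEqTorus q) ∧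
    -- minimality of the bound
    (∀ m : ℕ,
      (∀ (F : Type u) [Field F] (q : Matrix (Fin n) (Fin n) Fˣ), IsMulAntisymm q →
        IsMulTorsionFree (lambdaGroup q) →
        (m : Cardinal.{u}) ≤ rk (lambdaGroup q) → AutEqTorus q) →
      (n - 1).choose 2 + 1 ≤ m) ∧
    -- examples below the bound, over some field, and over every field that has room for them
    (∀ r : ℕ, r < (n - 1).choose 2 + 1 →
      (∃ (F : Type u) (_ : Field F) (q : Matrix (Fin n) (Fin n) Fˣ), IsMulAntisymm q ∧
        Nonempty (Additive (lambdaGroup q) ≃+ (Fin r → ℤ)) ∧ AutContainsSemidirect q) ∧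
      (∀ (F : Type u) [Field F], (r : Cardinal.{u}) ≤ rk Fˣ →
        ∃ q : Matrix (Fin n) (Fin n) Fˣ, IsMulAntisymm q ∧
          Nonempty (Additive (lambdaGroup q) ≃+ (Fin r → ℤ)) ∧ AutContainsSemidirect q)) := by
  refine ⟨fun F _ q hq htf hrk => (isRigid_of_le_rk hq htf hrk).autEqTorus, fun m hm => ?_,
    fun r hr => ⟨?_, fun F _ hF => exists_autContainsSemidirect F hn (Nat.lt_succ_iff.1 hr) hF⟩⟩
  -- For m < c, the example of rank exactly m over ℚ refutes the assumed property.
  · by_contra! hlt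
    obtain ⟨q, hq, ⟨e⟩, hs⟩ := exists_autContainsSemidirect (ULift.{u} ℚ) hn
      (Nat.lt_succ_iff.1 hlt) (le_rk_units_rat m)
    exact hs.not_autEqTorus
      (hm _ q hq (isMulTorsionFree_of_addEquiv e) (rk_of_addEquiv e).ge)
  · exact ⟨ULift.{u} ℚ, inferInstance,
      exists_autContainsSemidirect _ hn (Nat.lt_succ_iff.1 hr) (le_rk_units_rat r)⟩
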